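/- An instance of the problem \textsc{IncMax} is a countable (finite or infinite) set $U$ together with a monotone function $f\colon 2^U\to\mathbb{R}_{\ge 0}$ that is accountable, i.e., every nonempty $X\subseteq U$ contains an element $e$ with $f(X\setminus\{e\})\ge f(X)-f(X)/|X|$ (where $f(X)/|X|:=0$ for infinite $X$), and such that for every integer $k$ with $1\le k\le |U|$ the maximum $\mathrm{Opt}(k)=\max\{f(X) : X\subseteq U,\ |X|=k\}$ exists. A (deterministic) solution is an order $\sigma=(e_1,e_2,\dots)$ of all elements of $U$; it is $\alpha$-competitive if $\mathrm{Opt}(k)\le\alpha\, f(\{e_1,\dots,e_k\})$ for every integer $k$ with $1\le k\le|U|$. A deterministic algorithm assigns a solution to every instance; it is $\alpha$-competitive if all these solutions are $\alpha$-competitive, and its competitive ratio is the infimum of all $\alpha\ge1$ for which it is $\alpha$-competitive ($\infty$ if there is none). The deterministic competitive ratio of \textsc{IncMax} is the infimum of the competitive ratios of all deterministic algorithms. \textbf{Theorem.} The equation $-4\rho^{6}+24\rho^{4}-\rho^{3}-30\rho^{2}+31\rho-4=0$ has exactly one real solution $\rho^*\ge1$; it satisfies $\rho^*\ge 2.246$,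 and the deterministic competitive ratio of \textsc{IncMax} is at least $\rho^*$. In particular, it is at least $2.246$. -/

import Mathlib

open scoped NNReal

namespace IncMax

/-- A function `f : 2^U → ℝ≥0` is accountable if every nonempty `X` contains an element `e` with
`f(X \ {e}) ≥ f(X) - f(X) / |X|`. For infinite `X` the quotient `f(X) / |X|` is `0`
(`Set.ncard` is then `0`, and so is the quotient). -/
def Accountable {U : Type} (f : Set U → ℝ≥0) : Prop :=
  ∀ X : Set U, X.Nonempty →
    ∃ e ∈ X, (f X : ℝ) - (f X : ℝ) / (X.ncard : ℝ) ≤ (f (X \ {e}) : ℝ)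

/-- An instance of the incremental maximization problem: a countable (finite or infinite) ground
set with a monotone and accountable objective function, such that for every cardinality `k` the
maximum of the objective over the sets of cardinality `k` exists (automatic if `U` is finite). -/
structure Instance where
  U : Type
  countable_U : Countable U
  f : Set U → ℝ≥0
  monotone_f : Monotone f
  accountable_f : Accountable f
  exists_max : ∀ k : ℕ, (k : ℕ∞) ≤ ENat.card U →
    ∃ X : Set U, X.encard = k ∧ ∀ Y : Set U, Y.encard = k → f Y ≤ f X

/-- `Opt(k) = max {f(X) : |X| = k, X ⊆ U}`. The maximum exists for `k ≤ |U|`, see `isGreatest_opt`;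
the value is not used for other `k`. -/
noncomputable def Instance.opt (I : Instance) (k : ℕ) : ℝ≥0 :=
  sSup {y | ∃ X : Set I.U, X.encard = k ∧ I.f X = y}

theorem Instance.isGreatest_opt (I : Instance) (k : ℕ) (hk : (k : ℕ∞) ≤ ENat.card I.U) :
    IsGreatest {y | ∃ X : Set I.U, X.encard = k ∧ I.f X = y} (I.opt k) := by
  obtain ⟨X, hX, hmax⟩ := I.exists_max k hk
  have h : IsGreatest {y | ∃ X : Set I.U, X.encard = k ∧ I.f X = y} (I.f X) := by
    refine ⟨⟨X, hX, rfl⟩, ?_⟩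
    rintro y ⟨Y, hY, rfl⟩
    exact hmax Y hY
  have h2 : I.opt k = I.f X := h.csSup_eq
  rw [h2]
  exact h

/-- A deterministic solution: an order `(e₁, e₂, …)` of all elements of `U`, indexed (from `0`)
by the natural numbers smaller than `|U|`. -/
abbrev Solution (U : Type) : Type := {i : ℕ // (i : ℕ∞) < ENat.card U} ≃ U

/-- The set `{e₁, …, eₖ}` of the first `k` elements of a solution. -/
def Solution.pre {U : Type} (σ : Solution U) (k : ℕ) : Set U :=
  {x | (σ.symm x).1 < k}

/-- A solution is `α`-competitive if `Opt(k) / f({e₁, …, eₖ}) ≤ α` for all `1 ≤ k ≤ |U|`; written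
without a division, so that `f({e₁, …, eₖ}) = 0` is allowed only if `Opt(k) = 0`. -/
def Solution.IsCompetitive (I : Instance) (σ : Solution I.U) (α : ℝ) : Prop :=
  ∀ k : ℕ, 1 ≤ k → (k : ℕ∞) ≤ ENat.card I.U → (I.opt k : ℝ) ≤ α * (I.f (σ.pre k) : ℝ)

/-- A deterministic algorithm assigns a solution to every instance. -/
abbrev Algorithm : Type 1 := (I : Instance) → Solution I.U

/-- An algorithm is `α`-competitive if it produces an `α`-competitive solution on every instance. -/
def Algorithm.IsCompetitive (A : Algorithm) (α : ℝ) : Prop :=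
  ∀ I : Instance, Solution.IsCompetitive I (A I) α

/-- The competitive ratio of an algorithm: the infimum over all `α ≥ 1` such that the algorithm is
`α`-competitive (`⊤` if there is none). -/
noncomputable def Algorithm.competitiveRatio (A : Algorithm) : EReal :=
  sInf {x | ∃ α : ℝ, 1 ≤ α ∧ A.IsCompetitive α ∧ x = (α : EReal)}

/-- The deterministic competitive ratio of the incremental maximization problem: the infimum of the
competitive ratios of all deterministic algorithms. -/
noncomputable def competitiveRatio : EReal :=
  ⨅ A : Algorithm, Algorithm.competitiveRatio A

end IncMax

namespace IncMax

/-! ### The polynomial of the lower bound and the cubic whose discriminant it is -/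

/-! Let `α < κ < ρ*`. The hard instance consists of disjoint sets `R_0, …, R_{M+1}`, where `R_j` has
about `N κ^j r_j` elements and `f(X) = max_j |X ∩ R_j| / r_j`, so that all of `R_j` is worth about
`N κ^j`. By the end of any solution the best set is `R_{M+1}`, so the solution has to move on from
the small dense sets to the large sparse ones.

Let `R_i` be best for the last time among `R_0, …, R_i`, at time `T` with value `u`, and let `R_k`
be best next. Then `R_k` already holds about `u r_k` elements, which contribute nothing to the value
until then. Hence `T` is at least about `x + u r_i + u r_k`, where `x` counts the elements in the
earlier sets, while competitiveness against `R_{i+1}` gives `T ≤ α u r_{i+1}`. The recursion for `r`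
is chosen so that these bounds force `r_k < r_{i+2}` (`transition_bounds`). While `r` is
nondecreasing, this means `k = i + 1`: the sets become best one after the other. Once `r_{M+2} ≤
r_{M+1}`, the move away from `R_M` is impossible (`no_competitive_counts`).

It remains to see that `r` decreases at some point. Otherwise the growth factors of the sizes
converge to a real root `≥ κ` of a cubic (`exists_growth_lt`). This makes all three roots real, but
the discriminant is `-κ` times the sextic at `κ`, which is negative for `1 < κ < ρ*`. -/

theorem sextic_pos_of_lt {x z : ℝ} (hx : 1 ≤ x) (hxz : x < z)
    (hz : 0 ≤ -4 * z ^ 6 + 24 * z ^ 4 - z ^ 3 - 30 * z ^ 2 + 31 * z - 4) :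
    0 < -4 * x ^ 6 + 24 * x ^ 4 - x ^ 3 - 30 * x ^ 2 + 31 * x - 4 := by
  obtain ⟨y, rfl⟩ : ∃ y, x = 1 + y := ⟨x - 1, by ring⟩
  obtain ⟨w, rfl⟩ : ∃ w, z = 1 + w := ⟨z - 1, by ring⟩
  have hy : 0 ≤ y := by linarith
  have hyw : y < w := by linarith
  have hw : 0 < w := by linarith
  -- In powers of `x - 1` the sextic has one sign change, between degrees 3 and 4. Divided by `(x -
  -- 1)^4` it is therefore strictly decreasing; `key` is this comparison with denominators cleared,
  -- so that `y = 0` is allowed.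
  have hz' : w ^ 4 * (36 + 24 * w + 4 * w ^ 2) ≤ 16 + 40 * w + 51 * w ^ 2 + 15 * w ^ 3 := by
    linarith [hz, show -4 * (1 + w) ^ 6 + 24 * (1 + w) ^ 4 - (1 + w) ^ 3 - 30 * (1 + w) ^ 2
      + 31 * (1 + w) - 4 = 16 + 40 * w + 51 * w ^ 2 + 15 * w ^ 3
        - w ^ 4 * (36 + 24 * w + 4 * w ^ 2) by ring]
  have h2 : y ^ 2 ≤ w ^ 2 := by gcongr
  have h3 : y ^ 3 ≤ w ^ 3 := by gcongr
  have h4 : y ^ 4 < w ^ 4 := by gcongr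
  have key : 0 < w ^ 4 * (16 + 40 * y + 51 * y ^ 2 + 15 * y ^ 3
      - y ^ 4 * (36 + 24 * y + 4 * y ^ 2)) := by
    have e1 : 0 ≤ y ^ 4 * (16 + 40 * w + 51 * w ^ 2 + 15 * w ^ 3
        - w ^ 4 * (36 + 24 * w + 4 * w ^ 2)) := mul_nonneg (by positivity) (by linarith)
    have e2 : 0 ≤ y ^ 4 * w ^ 4 * (24 * (w - y) + 4 * (w ^ 2 - y ^ 2)) :=
      mul_nonneg (by positivity) (by linarith)
    have e3 : 0 ≤ y * w * (w ^ 3 - y ^ 3) := mul_nonneg (by positivity) (by linarith)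
    have e4 : 0 ≤ y ^ 2 * w ^ 2 * (w ^ 2 - y ^ 2) := mul_nonneg (by positivity) (by linarith)
    have e5 : 0 ≤ y ^ 3 * w ^ 3 * (w - y) := mul_nonneg (by positivity) (by linarith)
    linarith [show w ^ 4 * (16 + 40 * y + 51 * y ^ 2 + 15 * y ^ 3
      - y ^ 4 * (36 + 24 * y + 4 * y ^ 2)) = 16 * (w ^ 4 - y ^ 4) + 40 * (y * w * (w ^ 3 - y ^ 3))
      + 51 * (y ^ 2 * w ^ 2 * (w ^ 2 - y ^ 2)) + 15 * (y ^ 3 * w ^ 3 * (w - y))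
      + y ^ 4 * (16 + 40 * w + 51 * w ^ 2 + 15 * w ^ 3 - w ^ 4 * (36 + 24 * w + 4 * w ^ 2))
      + y ^ 4 * w ^ 4 * (24 * (w - y) + 4 * (w ^ 2 - y ^ 2)) by ring]
  have := pos_of_mul_pos_right key (by positivity)
  linarith [show -4 * (1 + y) ^ 6 + 24 * (1 + y) ^ 4 - (1 + y) ^ 3 - 30 * (1 + y) ^ 2
      + 31 * (1 + y) - 4 = 16 + 40 * y + 51 * y ^ 2 + 15 * y ^ 3
        - y ^ 4 * (36 + 24 * y + 4 * y ^ 2) by ring]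

theorem exists_sextic_root : ∃ ρ : ℝ, (2.246 : ℝ) ≤ ρ ∧
    -4 * ρ ^ 6 + 24 * ρ ^ 4 - ρ ^ 3 - 30 * ρ ^ 2 + 31 * ρ - 4 = 0 := by
  have h := intermediate_value_Icc' (a := (2.246 : ℝ)) (b := 2.247) (by norm_num)
    (f := fun ρ : ℝ => -4 * ρ ^ 6 + 24 * ρ ^ 4 - ρ ^ 3 - 30 * ρ ^ 2 + 31 * ρ - 4) (by fun_prop)
  obtain ⟨ρ, hρ, h0⟩ := h (show (0 : ℝ) ∈ _ by constructor <;> norm_num)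
  exact ⟨ρ, hρ.1, h0⟩

/-- The cubic changes sign on `[0, 1]`, so a root `q > 1` comes with a second real root, hence with
three. The discriminant is then nonnegative, and it equals `-κ` times the sextic. -/
theorem sextic_nonpos_of_cubic_root {κ q : ℝ} (hκ : 1 < κ) (hq : 1 < q)
    (h : q ^ 3 - (1 + κ ^ 2) * q ^ 2 + 2 * κ ^ 2 * q - κ ^ 2 + κ = 0) :
    -4 * κ ^ 6 + 24 * κ ^ 4 - κ ^ 3 - 30 * κ ^ 2 + 31 * κ - 4 ≤ 0 := by
  obtain ⟨x, hx, h0⟩ := intermediate_value_Icc (a := (0 : ℝ)) (b := 1) (by norm_num)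
    (f := fun x : ℝ => x ^ 3 - (1 + κ ^ 2) * x ^ 2 + 2 * κ ^ 2 * x - κ ^ 2 + κ) (by fun_prop)
    (show (0 : ℝ) ∈ _ by constructor <;> nlinarith)
  simp only at h0
  -- The third root, read off from the sum of the roots; `e1`, `e2`, `e3` are Vieta's formulas.
  obtain ⟨z, hz⟩ : ∃ z, z = 1 + κ ^ 2 - x - q := ⟨_, rfl⟩
  have hne : x - q ≠ 0 := by linarith [hx.2]
  have e1 : x + q + z = 1 + κ ^ 2 := by linarith
  have e2 : x * q + z * (x + q) = 2 * κ ^ 2 := by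
    apply mul_left_cancel₀ hne
    rw [hz]
    linear_combination h - h0
  have e3 : x * q * z = κ ^ 2 - κ := by
    linear_combination h + q ^ 2 * e1 * (-1) + q * e2
  have hd : 0 ≤ ((x - q) * (q - z) * (z - x)) ^ 2 := sq_nonneg _
  have e4 : ((x - q) * (q - z) * (z - x)) ^ 2
      = (x + q + z) ^ 2 * (x * q + z * (x + q)) ^ 2 - 4 * (x * q + z * (x + q)) ^ 3
        - 4 * (x + q + z) ^ 3 * (x * q * z)
        + 18 * (x + q + z) * (x * q + z * (x + q)) * (x * q * z) - 27 * (x * q * z) ^ 2 := by ring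
  rw [e4, e1, e2, e3] at hd
  by_contra hc
  push Not at hc
  have := mul_pos (by linarith : 0 < κ) hc
  nlinarith

/-! ### The sequence of set sizes -/

theorem exists_sizes (κ : ℝ) : ∃ t : ℕ → ℝ, t 0 = 1 ∧ t 1 = κ ^ 2 ∧
    ∀ i, t (i + 2) = κ ^ 2 * (t (i + 1) - t i - (∑ l ∈ Finset.range i, t l) / κ) := by
  -- The state is `(t i, t (i + 1), ∑ l < i, t l)`.
  let F : ℕ → ℝ × ℝ × ℝ := fun n => Nat.rec (1, κ ^ 2, 0)
    (fun _ p => (p.2.1, κ ^ 2 * (p.2.1 - p.1 - p.2.2 / κ), p.2.2 + p.1)) n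
  have hS : ∀ i, (F i).2.2 = ∑ l ∈ Finset.range i, (F l).1 := by
    intro i
    induction i with
    | zero => simp [F]
    | succ i ih => rw [Finset.sum_range_succ, ← ih]
  refine ⟨fun i => (F i).1, rfl, rfl, fun i => ?_⟩
  rw [← hS]

/-- If the sizes grew by a factor of at least `κ` forever, then the growth factors would converge to
a root of the characteristic polynomial. -/
theorem exists_growth_lt {κ : ℝ} (hκ : 1 < κ)
    (hP : 0 < -4 * κ ^ 6 + 24 * κ ^ 4 - κ ^ 3 - 30 * κ ^ 2 + 31 * κ - 4) {t : ℕ → ℝ}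
    (h0 : t 0 = 1) (h1 : t 1 = κ ^ 2)
    (ht : ∀ i, t (i + 2) = κ ^ 2 * (t (i + 1) - t i - (∑ l ∈ Finset.range i, t l) / κ)) :
    ∃ i, t (i + 1) < κ * t i := by
  by_contra! hc
  have hκ0 : 0 < κ := by linarith
  have hpos : ∀ i, 0 < t i := by
    intro i
    induction i with
    | zero => rw [h0]; norm_num
    | succ i ih => exact lt_of_lt_of_le (by positivity) (hc i)
  obtain ⟨q, hq⟩ : ∃ q : ℕ → ℝ, ∀ i, q i = t (i + 1) / t i := ⟨_, fun _ => rfl⟩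
  obtain ⟨s, hs⟩ : ∃ s : ℕ → ℝ, ∀ i, s i = (∑ l ∈ Finset.range i, t l) / t i := ⟨_, fun _ => rfl⟩
  have hqκ : ∀ i, κ ≤ q i := fun i => by rw [hq, le_div_iff₀ (hpos i)]; exact hc i
  have hq0 : ∀ i, 0 < q i := fun i => hκ0.trans_le (hqκ i)
  have hs0 : ∀ i, 0 ≤ s i := fun i => by
    rw [hs]; exact div_nonneg (Finset.sum_nonneg fun l _ => (hpos l).le) (hpos i).le
  have hqs : ∀ i, q (i + 1) = κ ^ 2 * (1 - (1 + s i / κ) / q i) := by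
    intro i
    have := hpos i; have := hpos (i + 1)
    rw [hq, hq, hs, ht]; field_simp; ring
  have hss : ∀ i, s (i + 1) = (s i + 1) / q i := by
    intro i
    have := hpos i; have := hpos (i + 1)
    rw [hs, hs, hq, Finset.sum_range_succ]; field_simp
  have hmono : ∀ i, q (i + 1) ≤ q i ∧ s i ≤ s (i + 1) := by
    intro i
    induction i with
    | zero =>
      have a0 : q 0 = κ ^ 2 := by rw [hq, h1, h0, div_one]
      have a1 : s 0 = 0 := by simp [hs]
      refine ⟨?_, by rw [a1]; exact hs0 _⟩
      rw [hqs, a0, a1]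
      have : 0 ≤ κ ^ 2 * ((1 + 0 / κ) / κ ^ 2) := by positivity
      linarith
    | succ i ih =>
      have := hq0 i; have := hq0 (i + 1); have := hs0 i; have := hs0 (i + 1)
      obtain ⟨ih1, ih2⟩ := ih
      constructor
      · calc q (i + 1 + 1) = κ ^ 2 * (1 - (1 + s (i + 1) / κ) / q (i + 1)) := hqs _
          _ ≤ κ ^ 2 * (1 - (1 + s i / κ) / q i) := by gcongr
          _ = q (i + 1) := (hqs i).symm
      · calc s (i + 1) = (s i + 1) / q i := hss i
          _ ≤ (s (i + 1) + 1) / q (i + 1) := by gcongr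
          _ = s (i + 1 + 1) := (hss _).symm
  have hanti : Antitone q := antitone_nat_of_succ_le fun i => (hmono i).1
  obtain ⟨Q, hQ⟩ : ∃ Q, Filter.Tendsto q Filter.atTop (nhds Q) :=
    ⟨_, tendsto_atTop_ciInf hanti ⟨κ, by rintro _ ⟨i, rfl⟩; exact hqκ i⟩⟩
  have hQκ : κ ≤ Q := ge_of_tendsto' hQ hqκ
  have hQ1 := (Filter.tendsto_add_atTop_iff_nat 1).2 hQ
  -- Solving the recursion of `q` for `s` makes `s` converge along with `q`, without a separate
  -- bound.
  have hs' : ∀ i, s i = (κ ^ 2 * (q i - 1) - q (i + 1) * q i) / κ := by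
    intro i
    have := hq0 i
    rw [hqs]; field_simp; ring
  have hS : Filter.Tendsto s Filter.atTop (nhds ((κ ^ 2 * (Q - 1) - Q * Q) / κ)) := by
    rw [funext hs']
    exact (((hQ.sub_const 1).const_mul _).sub (hQ1.mul hQ)).div_const _
  have hS1 := (Filter.tendsto_add_atTop_iff_nat 1).2 hS
  have hlim := tendsto_nhds_unique (hS1.mul hQ) ((hS.add_const 1).congr fun i => by
    have := hq0 i
    rw [hss]; field_simp)
  have : Q ^ 3 - (1 + κ ^ 2) * Q ^ 2 + 2 * κ ^ 2 * Q - κ ^ 2 + κ = 0 := by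
    field_simp at hlim
    linarith
  linarith [sextic_nonpos_of_cubic_root hκ (by linarith) this]

/-! ### The combinatorial core

`n j T` is the number of elements of the `j`-th set among the first `T` elements of a solution, `r j`
is the inverse of the density of the `j`-th set and `κ ^ j * r j` its size, up to the scale `N`. -/

/-- If the `i`-th set is best at time `T`, the sets before it hold at least `N * S / κ` elements, and
the `k`-th set is best at time `T + 1`, then `r k` is smaller than `r (i + 2)`, and the `i`-th set
holds at least a `1 / κ` fraction of its elements. -/
theorem transition_bounds {κ ρ N : ℝ} {i : ℕ} {r S : ℕ → ℝ} {T u x y rk : ℝ}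
    (hρ : 1 ≤ ρ) (hκρ : ρ < κ) (hNκ : κ < N) (hN : κ < N * (κ - ρ))
    (hr : 1 ≤ r i) (hr1 : r i ≤ r (i + 1)) (hrk : r (i + 1) ≤ rk)
    (hbase : i = 0 → S i = 0 ∧ r (i + 1) = κ * r i)
    (hrec : ∀ j, i = j + 1 → 1 ≤ r j ∧ r j ≤ r i ∧ 0 ≤ S j ∧ S i = S j + κ ^ j * r j ∧
      r (i + 1) = κ * r i - r j - S j / κ ^ i)
    (hrec' : r (i + 2) = κ * r (i + 1) - r i - S i / κ ^ (i + 1)) (hS : 0 ≤ S i)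
    (hx : N * S i / κ ≤ x) (hy : y = u * r i) (huN : u ≤ N * κ ^ i) (hu1 : i = 0 → 1 ≤ u)
    (hT : x + y + u * rk - 1 ≤ T) (hu0 : 0 ≤ u)
    (hcomp : ρ * u < N * κ ^ i - 1 → T ≤ ρ * u * r i)
    (hcomp' : ρ * u < N * κ ^ (i + 1) - 1 → T ≤ ρ * u * r (i + 1)) :
    N * (κ ^ i * r i) / κ ≤ y ∧ rk < r (i + 2) := by
  have hκ : 1 < κ := by linarith
  have hκ0 : 0 < κ := by linarith
  have hN0 : 0 < N := by linarith
  -- If `u < N κ^(i-1)`, then `R_i` can still serve as the competitor, and the bound `T ≤ ρ u r_i`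
  -- contradicts the elements already spent, since `r_k ≥ r_{i+1}`.
  have hA : N * κ ^ i / κ ≤ u := by
    by_contra! hlt
    rw [lt_div_iff₀ hκ0] at hlt
    have hp : 1 ≤ κ ^ i := one_le_pow₀ hκ.le
    have hT' := hcomp (by
      have h1 : κ < N * κ ^ i * (κ - ρ) := by nlinarith
      have h2 : u * κ * ρ ≤ N * κ ^ i * ρ := by gcongr
      have : κ * (ρ * u) < κ * (N * κ ^ i - 1) := by nlinarith
      exact lt_of_mul_lt_mul_left this hκ0.le)
    have hk : u * r (i + 1) ≤ u * rk := by gcongr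
    rcases Nat.eq_zero_or_pos i with h0 | hpos
    · obtain ⟨hS0, hr'⟩ := hbase h0
      have hx0 : 0 ≤ x := by rw [hS0] at hx; simpa using hx
      have := hu1 h0
      rw [hr'] at hk
      have e1 : u * r i * (κ + 1 - ρ) ≤ 1 := by nlinarith
      have e2 : 1 ≤ u * r i := by nlinarith
      nlinarith
    · obtain ⟨j, rfl⟩ : ∃ j, i = j + 1 := ⟨i - 1, by omega⟩
      obtain ⟨hj1, hj2, hSj, hSi, hr'⟩ := hrec j rfl
      have hpj : 0 < κ ^ j := by positivity
      have hlt' : u < N * κ ^ j := by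
        rw [pow_succ] at hlt
        exact lt_of_mul_lt_mul_right (by linarith [hlt]) hκ0.le
      rw [hr'] at hk
      have e1 : u * (S j / κ ^ (j + 1)) ≤ N * S j / κ := by
        calc u * (S j / κ ^ (j + 1)) ≤ N * κ ^ j * (S j / κ ^ (j + 1)) := by gcongr
          _ = N * S j / κ := by field_simp; ring
      have e2 : N * S (j + 1) / κ = N * S j / κ + N * (κ ^ j * r j) / κ := by rw [hSi]; ring
      have e3 : 1 < N * (κ ^ j * r j) / κ := by
        rw [lt_div_iff₀ hκ0]
        have : 1 ≤ κ ^ j * r j := one_le_mul_of_one_le_of_one_le (one_le_pow₀ hκ.le) hj1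
        nlinarith
      have e4 : u * r j ≤ u * r (j + 1) := by gcongr
      have e5 : 0 ≤ u * r (j + 1) * (κ - ρ) := by
        have : 0 ≤ r (j + 1) := by linarith
        have : 0 ≤ κ - ρ := by linarith
        positivity
      nlinarith
  refine ⟨?_, ?_⟩
  · rw [hy]
    calc N * (κ ^ i * r i) / κ = N * κ ^ i / κ * r i := by ring
      _ ≤ u * r i := by gcongr
  · by_contra! hge
    have hp : 1 ≤ κ ^ i := one_le_pow₀ hκ.le
    have hp0 : 0 < κ ^ i := by positivity
    -- Now `R_{i+1}` is the competitor. If `r_k ≥ r_{i+2}`, the recursion cancels `x` and `u r_i`,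
    -- leaving `κ u r_{i+1} - 1 ≤ ρ u r_{i+1}`, which fails because `u (κ - ρ) > 1`.
    have hT' := hcomp' (by
      have h1 : κ < N * κ ^ i * (κ - ρ) := by nlinarith
      have h2 : ρ * u ≤ ρ * (N * κ ^ i) := by gcongr
      rw [pow_succ]
      nlinarith)
    have hk : u * r (i + 2) ≤ u * rk := by gcongr
    rw [hrec'] at hk
    have e1 : u * (S i / κ ^ (i + 1)) ≤ N * S i / κ := by
      calc u * (S i / κ ^ (i + 1)) ≤ N * κ ^ i * (S i / κ ^ (i + 1)) := by gcongr
        _ = N * S i / κ := by field_simp; ring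
    have e2 : N / κ ≤ u := by
      refine le_trans ?_ hA
      gcongr
      nlinarith
    have e3 : 1 < u * (κ - ρ) := by
      rw [div_le_iff₀ hκ0] at e2
      have : κ * 1 < κ * (u * (κ - ρ)) := by nlinarith
      exact lt_of_mul_lt_mul_left this hκ0.le
    nlinarith

/-- Induction along the sets: each of `R_0, …, R_M` must be left for its immediate successor, but
leaving `R_M` would need `r (M + 1) < r (M + 2)`. In `hcomp`, `u` bounds the value at time `T`, and
the condition on `ρ * u` says that `R_l` is too valuable to be exhausted at that time. -/
theorem no_competitive_counts {κ ρ N : ℝ} {M K : ℕ} {r : ℕ → ℝ} {n : ℕ → ℕ → ℕ}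
    (hρ : 1 ≤ ρ) (hκρ : ρ < κ) (hNκ : κ < N) (hN : κ < N * (κ - ρ))
    (hr0 : r 0 = 1) (hr1 : r 1 = κ) (hmono : ∀ i ≤ M, r i ≤ r (i + 1))
    (hlast : r (M + 2) ≤ r (M + 1))
    (hrec : ∀ i, r (i + 2) = κ * r (i + 1) - r i
      - (∑ l ∈ Finset.range i, κ ^ l * r l) / κ ^ (i + 1))
    (n_mono : ∀ j, Monotone (n j)) (n_step : ∀ j T, n j (T + 1) ≤ n j T + 1)
    (n_sum : ∀ T ≤ K, ∑ j ∈ Finset.range (M + 2), n j T = T)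
    (n_size : ∀ j < M + 2, ∀ T, (n j T : ℝ) ≤ N * (κ ^ j * r j))
    (n_last : N * (κ ^ (M + 1) * r (M + 1)) - 1 ≤ n (M + 1) K) (hK : 1 ≤ K)
    (hcomp : ∀ T u, 1 ≤ T → T ≤ K → (∀ j < M + 2, (n j T : ℝ) / r j ≤ u) →
      ∀ l < M + 2, ρ * u < N * κ ^ l - 1 → (T : ℝ) ≤ ρ * u * r l) : False := by
  have hκ : 1 < κ := by linarith
  have hκ0 : 0 < κ := by linarith
  have hN0 : 0 < N := by linarith
  have hr : ∀ i j, i ≤ j → j ≤ M + 1 → r i ≤ r j := by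
    intro i j hij
    induction j, hij using Nat.le_induction with
    | base => exact fun _ => le_rfl
    | succ j _ ih => exact fun hj => (ih (by omega)).trans (hmono j (by omega))
  have hr1' : ∀ i, i ≤ M + 1 → 1 ≤ r i := fun i hi => hr0 ▸ hr 0 i (Nat.zero_le _) hi
  have hS : ∀ i, i ≤ M + 1 → 0 ≤ ∑ l ∈ Finset.range i, κ ^ l * r l := fun i hi =>
    Finset.sum_nonneg fun l hl => by
      have := hr1' l (by have := Finset.mem_range.1 hl; omega)
      positivity
  obtain ⟨best, hbest⟩ : ∃ best : ℕ → ℕ → Prop, ∀ i T, best i T ↔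
      ∀ j < M + 2, (n j T : ℝ) / r j ≤ n i T / r i := ⟨_, fun _ _ => Iff.rfl⟩
  have exists_best : ∀ T, ∃ k < M + 2, best k T := by
    intro T
    obtain ⟨k, hk, hmax⟩ := Finset.exists_max_image (Finset.range (M + 2))
      (fun j => (n j T : ℝ) / r j) ⟨0, by simp⟩
    exact ⟨k, Finset.mem_range.1 hk, (hbest _ _).2 fun j hj => hmax j (Finset.mem_range.2 hj)⟩
  have exists_last : ∀ i T, T ≤ K → (∃ l ≤ i, best l T) → ∃ T', T ≤ T' ∧ T' ≤ K ∧
      (∃ l ≤ i, best l T') ∧ ∀ T'', T' < T'' → T'' ≤ K → ∀ l ≤ i, ¬ best l T'' := by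
    classical
    intro i T hT h
    refine ⟨Nat.findGreatest (fun T => ∃ l ≤ i, best l T) K, Nat.le_findGreatest hT h,
      Nat.findGreatest_le _, Nat.findGreatest_spec (P := fun T => ∃ l ≤ i, best l T) hT h, ?_⟩
    intro T'' h1 h2 l hl hb
    exact Nat.findGreatest_is_greatest h1 h2 ⟨l, hl, hb⟩
  -- The invariant: there is a last time at which one of `R_0, …, R_i` is best, `R_i` itself is best
  -- then, and the sets before it hold at least a `1 / κ` fraction of their nominal sizes in total.
  obtain ⟨P, hP⟩ : ∃ P : ℕ → Prop, ∀ i, P i ↔ ∃ T, 1 ≤ T ∧ T ≤ K ∧ best i T ∧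
      (∀ T', T < T' → T' ≤ K → ∀ l ≤ i, ¬ best l T') ∧
      N * (∑ l ∈ Finset.range i, κ ^ l * r l) / κ ≤ ∑ l ∈ Finset.range i, (n l T : ℝ) ∧
      (i = 0 → 1 ≤ n 0 T) := ⟨_, fun _ => Iff.rfl⟩
  have hP0 : P 0 := by
    have hsum := n_sum 1 hK
    -- A first element outside `R_0` has value at most `1 / κ`, whereas one element of `R_0` has
    -- value `1`.
    have hn0 : n 0 1 = 1 := by
      by_contra hne
      have hle : ∀ j < M + 2, n j 1 ≤ 1 := fun j hj =>
        (Finset.single_le_sum (f := fun j => n j 1) (fun _ _ => Nat.zero_le _)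
          (Finset.mem_range.2 hj)).trans_eq hsum
      have h := hcomp 1 (1 / κ) le_rfl hK (fun j hj => by
        rcases Nat.eq_zero_or_pos j with rfl | hpos
        · have : n 0 1 = 0 := by have := hle 0 hj; omega
          rw [this]
          simp only [Nat.cast_zero, zero_div]
          positivity
        · have h1 : κ ≤ r j := hr1 ▸ hr 1 j hpos (by omega)
          have : (n j 1 : ℝ) ≤ 1 := by exact_mod_cast hle j hj
          gcongr) 0 (by omega) (by
            have : ρ * (1 / κ) < 1 := by rw [mul_one_div, div_lt_one hκ0]; exact hκρ
            have : 2 < N := by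
              by_contra h
              nlinarith
            simp only [pow_zero, mul_one]
            linarith)
      rw [hr0, mul_one, mul_one_div, le_div_iff₀ hκ0] at h
      norm_num at h
      linarith
    have hb : best 0 1 := by
      refine (hbest _ _).2 fun j hj => ?_
      rcases Nat.eq_zero_or_pos j with rfl | hpos
      · exact le_rfl
      · have : n j 1 = 0 := by
          have h2 : ∑ j ∈ {0, j}, n j 1 ≤ ∑ j ∈ Finset.range (M + 2), n j 1 :=
            Finset.sum_le_sum_of_subset (by
              intro a ha
              simp only [Finset.mem_insert, Finset.mem_singleton] at ha
              rw [Finset.mem_range]; omega)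
          rw [Finset.sum_pair hpos.ne, hsum] at h2
          omega
        rw [this, hn0, hr0]
        simp
    obtain ⟨T, h1, h2, ⟨l, hl, hlb⟩, h4⟩ := exists_last 0 1 hK ⟨0, le_rfl, hb⟩
    obtain rfl : l = 0 := by omega
    exact (hP 0).2 ⟨T, h1, h2, hlb, h4, by simp, fun _ => hn0 ▸ n_mono 0 h1⟩
  have hstep : ∀ i ≤ M, P i → i < M ∧ P (i + 1) := by
    intro i hi hPi
    obtain ⟨T, hT1, hTK, hb, hafter, hx, hn0⟩ := (hP i).1 hPi
    rw [hbest] at hb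
    have hri := hr1' i (by omega)
    have hri0 : 0 < r i := by linarith
    have huN : (n i T : ℝ) / r i ≤ N * κ ^ i := by
      rw [div_le_iff₀ hri0]
      linarith [n_size i (by omega) T]
    -- At time `K` the last set is complete up to rounding, and its value exceeds `N κ^M`, which
    -- bounds the value of `R_i`.
    have hlt : T < K := by
      refine lt_of_le_of_ne hTK fun h => ?_
      subst h
      have h1 := hb (M + 1) (by omega)
      have hrM := hr1' (M + 1) le_rfl
      rw [div_le_iff₀ (by linarith)] at h1
      have h2 : N * κ ^ i ≤ N * κ ^ M := by gcongr; exact hκ.le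
      have h3 : (n (M + 1) T : ℝ) ≤ N * κ ^ M * r (M + 1) := by
        refine h1.trans ?_
        gcongr
        exact huN.trans h2
      have h4 : 1 ≤ κ ^ M := one_le_pow₀ hκ.le
      have h5 : 1 ≤ κ ^ M * r (M + 1) := one_le_mul_of_one_le_of_one_le h4 hrM
      have h6 : 1 < N * (κ - 1) := by nlinarith
      have h7 : 1 < (κ ^ M * r (M + 1)) * (N * (κ - 1)) := one_lt_mul_of_le_of_lt h5 h6
      rw [pow_succ] at n_last
      nlinarith
    obtain ⟨k, hk, hkb⟩ := exists_best (T + 1)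
    have hik : i < k := by
      by_contra! h
      exact hafter (T + 1) (by omega) (by omega) k h hkb
    have hkb' := (hbest _ _).1 hkb
    have hrk := hr1' k (by omega)
    have key := transition_bounds (κ := κ) (ρ := ρ) (N := N) (i := i) (r := r)
      (S := fun i => ∑ l ∈ Finset.range i, κ ^ l * r l) (T := T) (u := n i T / r i)
      (x := ∑ l ∈ Finset.range i, (n l T : ℝ)) (y := n i T) (rk := r k) hρ hκρ hNκ hN hri
      (hmono i hi) (hr _ _ hik (by omega))
      (fun h => by subst h; simp [hr0, hr1])
      (fun j hj => by
        subst hj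
        exact ⟨hr1' j (by omega), hmono j (by omega), hS j (by omega),
          Finset.sum_range_succ _ _, hrec j⟩)
      (hrec i) (hS i (by omega)) hx (by field_simp) huN
      (fun h => by subst h; rw [hr0, div_one]; exact_mod_cast hn0 rfl)
      (by
        -- `R_k` overtakes with a single new element, so one step earlier it was at most one element
        -- short of `u r_k`.
        have h1 : (n i T : ℝ) / r i * r k ≤ n k T + 1 := by
          rw [← le_div_iff₀ (by linarith)]
          calc (n i T : ℝ) / r i ≤ n i (T + 1) / r i := by
                gcongr
                exact n_mono i (Nat.le_succ T)
            _ ≤ n k (T + 1) / r k := hkb' i (by omega)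
            _ ≤ (n k T + 1) / r k := by
                gcongr
                exact_mod_cast n_step k T
        have h2 : ∑ l ∈ insert k (Finset.range (i + 1)), n l T ≤ T := by
          conv_rhs => rw [← n_sum T hTK]
          refine Finset.sum_le_sum_of_subset fun a ha => ?_
          simp only [Finset.mem_insert, Finset.mem_range] at ha ⊢
          omega
        rw [Finset.sum_insert (by simp; omega), Finset.sum_range_succ] at h2
        have h3 : (n k T : ℝ) + (∑ l ∈ Finset.range i, (n l T : ℝ) + n i T) ≤ T := by
          exact_mod_cast h2
        linarith)
      (by positivity)
      (hcomp T _ hT1 hTK hb i (by omega)) (hcomp T _ hT1 hTK hb (i + 1) (by omega))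
    obtain ⟨key1, key2⟩ := key
    have hki : k = i + 1 := by
      by_contra hne
      exact absurd (hr (i + 2) k (by omega) (by omega)) (not_le.2 key2)
    subst hki
    have hiM : i < M := by
      refine lt_of_le_of_ne hi fun h => ?_
      subst h
      exact absurd hlast (not_le.2 key2)
    refine ⟨hiM, (hP _).2 ?_⟩
    obtain ⟨T', h1, h2, ⟨l, hl, hlb⟩, h4⟩ := exists_last (i + 1) (T + 1) hlt ⟨_, le_rfl, hkb⟩
    obtain rfl : l = i + 1 := by
      by_contra hne
      exact hafter T' (by omega) h2 l (by omega) hlb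
    refine ⟨T', by omega, h2, hlb, h4, ?_, by omega⟩
    calc N * (∑ l ∈ Finset.range (i + 1), κ ^ l * r l) / κ
        = N * (∑ l ∈ Finset.range i, κ ^ l * r l) / κ + N * (κ ^ i * r i) / κ := by
          rw [Finset.sum_range_succ]; ring
      _ ≤ ∑ l ∈ Finset.range i, (n l T : ℝ) + n i T := add_le_add hx key1
      _ = ∑ l ∈ Finset.range (i + 1), (n l T : ℝ) := (Finset.sum_range_succ _ _).symm
      _ ≤ ∑ l ∈ Finset.range (i + 1), (n l T' : ℝ) := by
          gcongr with l
          exact n_mono l (by omega)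
  have hall : ∀ i ≤ M, P i := by
    intro i
    induction i with
    | zero => exact fun _ => hP0
    | succ i ih => exact fun hi => (hstep i (by omega) (ih (by omega))).2
  exact absurd (hstep M le_rfl (hall M le_rfl)).1 (lt_irrefl M)

/-! ### Instances made of disjoint sets with constant densities -/

/-- The disjoint union of `m` sets with `s 0, …, s (m - 1)` elements. -/
abbrev Blocks (m : ℕ) (s : ℕ → ℕ) : Type := Σ j : Fin m, Fin (s j)

variable {m : ℕ} {s : ℕ → ℕ}

/-- The `j`-th of the disjoint sets. -/
def block (m : ℕ) (s : ℕ → ℕ) (j : ℕ) : Set (Blocks m s) := {x | x.1.1 = j}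

/-- The number of elements of `X` in the `j`-th set. -/
noncomputable def blockCount (X : Set (Blocks m s)) (j : ℕ) : ℕ := (X ∩ block m s j).ncard

theorem blockCount_mono (j : ℕ) : Monotone fun X : Set (Blocks m s) => blockCount X j :=
  fun _ _ h => Set.ncard_le_ncard (Set.inter_subset_inter_left _ h) (Set.toFinite _)

theorem ncard_block {j : ℕ} (hj : j < m) : (block m s j).ncard = s j := by
  have : block m s j = Set.range fun a : Fin (s j) => (⟨⟨j, hj⟩, a⟩ : Blocks m s) := by
    ext ⟨⟨i, hi⟩, a⟩
    simp only [block, Set.mem_ofPred_eq, Set.mem_range]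
    constructor
    · rintro rfl
      exact ⟨a, rfl⟩
    · rintro ⟨b, hb⟩
      cases hb
      rfl
  rw [this, ← Set.image_univ, Set.ncard_image_of_injective _ (fun a b h => by simpa using h),
    Set.ncard_univ, Nat.card_fin]

theorem blockCount_le (X : Set (Blocks m s)) {j : ℕ} (hj : j < m) : blockCount X j ≤ s j :=
  ncard_block (s := s) hj ▸ Set.ncard_le_ncard Set.inter_subset_right (Set.toFinite _)

theorem sum_blockCount (X : Set (Blocks m s)) :
    ∑ j ∈ Finset.range m, blockCount X j = X.ncard := by
  classical
  rw [Set.ncard_eq_toFinset_card' X, Finset.card_eq_sum_card_fiberwise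
    (f := fun x : Blocks m s => x.1.1) (t := Finset.range m) fun x _ => by simp]
  refine Finset.sum_congr rfl fun j _ => ?_
  rw [blockCount, Set.ncard_eq_toFinset_card']
  congr 1
  ext x
  rw [Set.mem_toFinset, Finset.mem_filter, Set.mem_toFinset]
  rfl

/-- The objective `X ↦ max_j d_j |X ∩ R_j|` for disjoint sets `R_j`. -/
noncomputable def blockValue (d : ℕ → ℝ≥0) (X : Set (Blocks m s)) : ℝ≥0 :=
  (Finset.range m).sup fun j => d j * blockCount X j

theorem le_blockValue (d : ℕ → ℝ≥0) (X : Set (Blocks m s)) {j : ℕ} (hj : j < m) :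
    d j * blockCount X j ≤ blockValue d X :=
  Finset.le_sup (f := fun j => d j * (blockCount X j : ℝ≥0)) (Finset.mem_range.2 hj)

/-- Let `R_j` attain the maximum. Removing an element outside `R_j` costs nothing; if there is none,
then `X ⊆ R_j` and each element carries exactly `f(X) / |X|`. -/
theorem blockValue_accountable (d : ℕ → ℝ≥0) :
    Accountable (blockValue d : Set (Blocks m s) → ℝ≥0) := by
  rintro X ⟨e, he⟩
  obtain ⟨j, hj, hX⟩ := Finset.exists_mem_eq_sup (Finset.range m)
    ⟨e.1.1, Finset.mem_range.2 e.1.2⟩ fun j => d j * (blockCount X j : ℝ≥0)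
  change blockValue d X = _ at hX
  rw [Finset.mem_range] at hj
  by_cases h : ∃ e ∈ X, e ∉ block m s j
  · obtain ⟨e, heX, hej⟩ := h
    refine ⟨e, heX, ?_⟩
    have h1 : blockCount (X \ {e}) j = blockCount X j := by
      rw [blockCount, blockCount]
      congr 1
      ext x
      simp only [Set.mem_inter_iff, Set.mem_sdiff, Set.mem_singleton_iff]
      exact ⟨fun h => ⟨h.1.1, h.2⟩, fun h => ⟨⟨h.1, fun hx => hej (hx ▸ h.2)⟩, h.2⟩⟩
    have h2 : (blockValue d X : ℝ) ≤ blockValue d (X \ {e}) := by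
      rw [hX, ← h1]
      exact_mod_cast le_blockValue d (X \ {e}) hj
    have : 0 ≤ (blockValue d X : ℝ) / X.ncard := by positivity
    linarith
  · push Not at h
    refine ⟨e, he, ?_⟩
    have h1 : blockCount X j = X.ncard := by rw [blockCount, Set.inter_eq_left.2 h]
    have h2 : blockCount (X \ {e}) j + 1 = X.ncard := by
      rw [blockCount, Set.inter_eq_left.2 (Set.sdiff_subset.trans h),
        Set.ncard_sdiff_singleton_add_one he (Set.toFinite _)]
    have h3 : (d j : ℝ) * blockCount (X \ {e}) j ≤ blockValue d (X \ {e}) := by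
      exact_mod_cast le_blockValue d (X \ {e}) hj
    have h4 : (X.ncard : ℝ) ≠ 0 := by rw [← h2]; positivity
    rw [hX, h1]
    push_cast
    rw [mul_div_cancel_right₀ _ h4, ← h2]
    push_cast
    linarith

/-- The instance with ground set `Blocks m s` and objective `blockValue d`. -/
noncomputable def blockInstance (m : ℕ) (s : ℕ → ℕ) (d : ℕ → ℝ≥0) : Instance where
  U := Blocks m s
  countable_U := inferInstance
  f := blockValue d
  monotone_f _ _ h := Finset.sup_mono_fun fun j _ => by
    have := blockCount_mono j h
    gcongr
  accountable_f := blockValue_accountable d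
  exists_max k hk := by
    obtain ⟨X₀, -, hX₀⟩ := Set.exists_subset_encard_eq (s := (Set.univ : Set (Blocks m s)))
      (k := (k : ℕ∞)) (hk.trans_eq (Set.encard_univ _).symm)
    obtain ⟨X, hX, hmax⟩ := Set.exists_max_image {X : Set (Blocks m s) | X.encard = k}
      (blockValue d) (Set.toFinite _) ⟨X₀, hX₀⟩
    exact ⟨X, hX, hmax⟩

theorem le_opt_blockInstance (d : ℕ → ℝ≥0) {k j : ℕ} (hj : j < m)
    (hk : (k : ℕ∞) ≤ ENat.card (Blocks m s)) :
    d j * (min k (s j) : ℕ) ≤ (blockInstance m s d).opt k := by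
  have hgr := (blockInstance m s d).isGreatest_opt k hk
  have hcard : (block m s j).encard = (s j : ℕ) := by
    rw [← ncard_block (s := s) hj, Set.Finite.cast_ncard_eq (Set.toFinite _)]
  obtain ⟨X, hX, hXj⟩ : ∃ X : Set (Blocks m s), X.encard = k ∧ min k (s j) ≤ blockCount X j := by
    rcases le_total k (s j) with h | h
    · obtain ⟨X, hXs, hX⟩ := Set.exists_subset_encard_eq (s := block m s j) (k := (k : ℕ∞))
        (by rw [hcard]; exact_mod_cast h)
      refine ⟨X, hX, ?_⟩
      rw [blockCount, Set.inter_eq_left.2 hXs, Set.ncard, hX]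
      simp
    · obtain ⟨X, hXs, -, hX⟩ := Set.exists_superset_subset_encard_eq (Set.subset_univ (block m s j))
        (k := (k : ℕ∞)) (by rw [hcard]; exact_mod_cast h) (by rwa [Set.encard_univ])
      refine ⟨X, hX, ?_⟩
      rw [blockCount, Set.inter_eq_right.2 hXs, ncard_block hj]
      exact min_le_right _ _
  have h1 : blockValue d X ≤ (blockInstance m s d).opt k := hgr.2 ⟨X, hX, rfl⟩
  refine le_trans ?_ h1
  refine le_trans ?_ (le_blockValue d X hj)
  gcongr

/-! ### Prefixes of solutions -/

theorem Solution.pre_mono {U : Type} (σ : Solution U) : Monotone σ.pre :=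
  fun _ _ h _ hx => lt_of_lt_of_le hx h

theorem Solution.ncard_pre {U : Type} (σ : Solution U) {k : ℕ} (hk : (k : ℕ∞) ≤ ENat.card U) :
    (σ.pre k).ncard = k := by
  have h1 : σ.pre k = σ '' {i | i.1 < k} := by
    rw [Equiv.image_eq_preimage_symm]
    rfl
  have h2 : Subtype.val '' {i : {i : ℕ // (i : ℕ∞) < ENat.card U} | i.1 < k} = Set.Iio k := by
    ext i
    simp only [Set.mem_image, Set.mem_ofPred_eq, Subtype.exists, exists_and_left, exists_prop,
      exists_eq_right_right, Set.mem_Iio, and_iff_left_iff_imp]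
    exact fun hi => lt_of_lt_of_le (by exact_mod_cast hi) hk
  rw [h1, Set.ncard_image_of_injective _ σ.injective,
    ← Set.ncard_image_of_injective _ Subtype.val_injective, h2, ← Finset.coe_Iio,
    Set.ncard_coe_finset, Nat.card_Iio]

theorem Solution.pre_succ_subset {U : Type} (σ : Solution U) (k : ℕ) :
    ∃ A : Set U, A.ncard ≤ 1 ∧ σ.pre (k + 1) ⊆ σ.pre k ∪ A := by
  have hsub : {x | (σ.symm x).1 = k}.Subsingleton := fun x hx y hy =>
    σ.symm.injective (Subtype.ext (hx.trans hy.symm))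
  have := hsub.finite.to_subtype
  exact ⟨_, Set.ncard_le_one_iff_subsingleton.2 hsub, fun x hx =>
    Nat.lt_succ_iff_lt_or_eq.1 (show (σ.symm x).1 < k + 1 from hx)⟩

theorem blockCount_pre_succ (σ : Solution (Blocks m s)) (j k : ℕ) :
    blockCount (σ.pre (k + 1)) j ≤ blockCount (σ.pre k) j + 1 := by
  obtain ⟨A, hA, hsub⟩ := σ.pre_succ_subset k
  calc blockCount (σ.pre (k + 1)) j ≤ ((σ.pre k ∩ block m s j) ∪ A).ncard :=
        Set.ncard_le_ncard (fun x hx => (hsub hx.1).imp (fun h => ⟨h, hx.2⟩) id) (Set.toFinite _)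
    _ ≤ blockCount (σ.pre k) j + A.ncard := Set.ncard_union_le _ _
    _ ≤ _ := by gcongr

/-! ### The lower bound -/

theorem not_isCompetitive {α κ : ℝ} (hα : 1 ≤ α) (hακ : α < κ)
    (hP : 0 < -4 * κ ^ 6 + 24 * κ ^ 4 - κ ^ 3 - 30 * κ ^ 2 + 31 * κ - 4) (A : Algorithm) :
    ¬ A.IsCompetitive α := by
  classical
  intro hA
  have hκ : 1 < κ := by linarith
  have hκ0 : 0 < κ := by linarith
  obtain ⟨t, h0, h1, ht⟩ := exists_sizes κ
  have hex := exists_growth_lt hκ hP h0 h1 ht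
  -- The first failure of growth by `κ` is not at index `0`, because `t 1 = κ^2 > κ`.
  obtain ⟨M, hM, hlt⟩ : ∃ M, t (M + 2) < κ * t (M + 1) ∧ ∀ i ≤ M, κ * t i ≤ t (i + 1) := by
    obtain ⟨i, hi, hmin⟩ : ∃ i, t (i + 1) < κ * t i ∧ ∀ j < i, κ * t j ≤ t (j + 1) :=
      ⟨Nat.find hex, Nat.find_spec hex, fun j hj => not_lt.1 (Nat.find_min hex hj)⟩
    cases i with
    | zero => rw [zero_add, h0, h1] at hi; nlinarith
    | succ M => exact ⟨M, hi, fun i hi => hmin i (by omega)⟩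
  obtain ⟨r, hr⟩ : ∃ r : ℕ → ℝ, ∀ i, t i = κ ^ i * r i :=
    ⟨fun i => t i / κ ^ i, fun i => by field_simp⟩
  have hpow : ∀ i, 0 < κ ^ i := fun i => by positivity
  have hr0 : r 0 = 1 := by simpa [h0] using (hr 0).symm
  have hr1 : r 1 = κ := by
    have := hr 1
    rw [h1] at this
    apply mul_left_cancel₀ hκ0.ne'
    linarith
  have hmono : ∀ i ≤ M, r i ≤ r (i + 1) := by
    intro i hi
    have := hlt i hi
    rw [hr, hr, pow_succ] at this
    have := hpow (i + 1)
    rw [pow_succ] at this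
    refine le_of_mul_le_mul_left ?_ this
    linarith
  have hlast : r (M + 2) ≤ r (M + 1) := by
    rw [hr, hr, pow_succ κ (M + 1)] at hM
    have := hpow (M + 2)
    rw [pow_succ κ (M + 1)] at this
    refine (lt_of_mul_lt_mul_left ?_ this.le).le
    linarith
  have hrec : ∀ i, r (i + 2) = κ * r (i + 1) - r i
      - (∑ l ∈ Finset.range i, κ ^ l * r l) / κ ^ (i + 1) := by
    intro i
    have h := ht i
    rw [Finset.sum_congr rfl fun l _ => hr l, hr, hr, hr] at h
    have := hpow i
    apply mul_left_cancel₀ (hpow (i + 2)).ne'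
    rw [h]
    field_simp
    ring
  have hr1' : ∀ i < M + 2, 1 ≤ r i := by
    intro i
    induction i with
    | zero => exact fun _ => hr0.ge
    | succ i ih => exact fun hi => (ih (by omega)).trans (hmono i (by omega))
  -- The second bound gives `N (κ - α) > κ`, which absorbs the errors of rounding the set sizes.
  obtain ⟨N, hN⟩ := exists_nat_gt (max κ (κ / (κ - α)))
  obtain ⟨hN1, hN2⟩ := max_lt_iff.1 hN
  rw [div_lt_iff₀ (by linarith)] at hN2
  obtain ⟨s, hs⟩ : ∃ s : ℕ → ℕ, ∀ j, s j = ⌊(N : ℝ) * t j⌋₊ := ⟨_, fun _ => rfl⟩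
  obtain ⟨d, hd⟩ : ∃ d : ℕ → ℝ≥0, ∀ j < M + 2, (d j : ℝ) = 1 / r j :=
    ⟨fun j => (1 / r j).toNNReal, fun j hj => by
      have := hr1' j hj
      exact Real.coe_toNNReal _ (by positivity)⟩
  have hs_le : ∀ j < M + 2, (s j : ℝ) ≤ N * (κ ^ j * r j) := fun j hj => by
    have := hr1' j hj
    rw [hs, hr]
    exact Nat.floor_le (by positivity)
  have hs_ge : ∀ j, N * (κ ^ j * r j) - 1 < s j := fun j => by
    rw [hs, hr]
    exact Nat.sub_one_lt_floor _
  obtain ⟨σ, hσ⟩ : ∃ σ : Solution (Blocks (M + 2) s),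
      Solution.IsCompetitive (blockInstance (M + 2) s d) σ α := ⟨_, hA _⟩
  have hcard : ((Nat.card (Blocks (M + 2) s) : ℕ) : ℕ∞) = ENat.card (Blocks (M + 2) s) := by
    rw [Nat.card_eq_fintype_card, ENat.card_eq_coe_fintype_card]
  have hle : ∀ T ≤ Nat.card (Blocks (M + 2) s), (T : ℕ∞) ≤ ENat.card (Blocks (M + 2) s) :=
    fun T hT => hcard ▸ by exact_mod_cast hT
  have huniv : σ.pre (Nat.card (Blocks (M + 2) s)) = Set.univ := by
    refine Set.eq_of_subset_of_ncard_le (Set.subset_univ _) ?_ (Set.toFinite _)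
    rw [σ.ncard_pre hcard.le, Set.ncard_univ]
  have hK : 1 ≤ Nat.card (Blocks (M + 2) s) := by
    have : 0 < s 0 := by
      have := hs_ge 0
      rw [pow_zero, hr0, one_mul, mul_one] at this
      have h2 : (0 : ℝ) < s 0 := by linarith
      exact_mod_cast h2
    have : Nonempty (Blocks (M + 2) s) := ⟨⟨0, ⟨0, this⟩⟩⟩
    exact Nat.card_pos
  refine no_competitive_counts (N := N) (M := M) (K := Nat.card (Blocks (M + 2) s)) (r := r)
    (n := fun j T => blockCount (σ.pre T) j) hα hακ hN1 hN2 hr0 hr1 hmono hlast hrec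
    (fun j => (blockCount_mono j).comp σ.pre_mono) (fun j T => blockCount_pre_succ σ j T)
    (fun T hT => by rw [sum_blockCount, σ.ncard_pre (hle T hT)])
    (fun j hj T => le_trans (by exact_mod_cast blockCount_le _ hj) (hs_le j hj)) ?_ hK ?_
  · simp only [huniv]
    rw [blockCount, Set.univ_inter, ncard_block (by omega)]
    exact (hs_ge _).le
  · intro T u hT1 hTK hu l hl hul
    have hopt := hσ T hT1 (hle T hTK)
    have hrl := hr1' l hl
    have hrl0 : 0 < r l := by linarith
    have hval : (blockValue d (σ.pre T) : ℝ) ≤ u := by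
      obtain ⟨j, hj, hX⟩ := Finset.exists_mem_eq_sup (Finset.range (M + 2))
        ⟨0, by simp⟩ fun j => d j * (blockCount (σ.pre T) j : ℝ≥0)
      change blockValue d (σ.pre T) = _ at hX
      rw [Finset.mem_range] at hj
      rw [hX, NNReal.coe_mul, hd j hj, one_div_mul_eq_div]
      exact hu j hj
    have hmin : (d l : ℝ) * (min T (s l) : ℕ) ≤ α * u := by
      refine le_trans ?_ (hopt.trans (mul_le_mul_of_nonneg_left hval (by linarith)))
      exact_mod_cast le_opt_blockInstance d hl (hle T hTK)
    rw [hd l hl, one_div_mul_eq_div, div_le_iff₀ hrl0] at hmin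
    -- The case `s l ≤ T` is void: it gives `s l ≤ α u r_l`, below `(N κ^l - 1) r_l ≤ N κ^l r_l - 1
    -- < s l`.
    rcases le_total T (s l) with h | h
    · rwa [min_eq_left h] at hmin
    · rw [min_eq_right h] at hmin
      have := hs_ge l
      nlinarith

end IncMax

theorem mainTheorem1 :
    ∃ ρ : ℝ,
      (1 ≤ ρ ∧ -4 * ρ ^ 6 + 24 * ρ ^ 4 - ρ ^ 3 - 30 * ρ ^ 2 + 31 * ρ - 4 = 0) ∧
      (∀ x : ℝ, 1 ≤ x → -4 * x ^ 6 + 24 * x ^ 4 - x ^ 3 - 30 * x ^ 2 + 31 * x - 4 = 0 → x = ρ) ∧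
      (2.246 : ℝ) ≤ ρ ∧
      (ρ : EReal) ≤ IncMax.competitiveRatio := by
  obtain ⟨ρ, hρ, h0⟩ := IncMax.exists_sextic_root
  have hρ1 : 1 ≤ ρ := le_trans (by norm_num) hρ
  refine ⟨ρ, ⟨hρ1, h0⟩, fun x hx hx0 => ?_, hρ, ?_⟩
  · rcases lt_trichotomy x ρ with h | h | h
    · exact absurd hx0 (IncMax.sextic_pos_of_lt hx h h0.ge).ne'
    · exact h
    · exact absurd h0 (IncMax.sextic_pos_of_lt hρ1 h hx0.ge).ne'
  · refine le_iInf fun A => le_sInf ?_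
    rintro _ ⟨α, hα, hA, rfl⟩
    rw [EReal.coe_le_coe_iff]
    by_contra! hlt
    obtain ⟨κ, hακ, hκρ⟩ := exists_between hlt
    exact IncMax.not_isCompetitive hα hακ
      (IncMax.sextic_pos_of_lt (hα.trans hακ.le) hκρ h0.ge) A hA
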